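/- Conventions. A finite partly cancellative nilsemigroup is a finite commutative monoid $(N,+)$ with identity $0$ and an absorbing element $\infty\neq 0$ such that every $a\ne 0$ has a multiple $ka=\infty$, and such that $a+b=a+c\neq\infty$ implies $b=c$. Write $\mathsf m(N)=|N|-1$ for the number of non-nil elements, $\mathsf e(N)$ for one more than the number of atoms (irreducible elements) of $N$, and call $\mathsf m(N)-\mathsf e(N)$ the embedding codimension of $N$. Let $\varphi_N:\mathbb Z_{\ge 0}^{\mathsf e(N)-1}\to N$ be the factorization homomorphism, with one coordinate for each atom, and $\mathsf Z_N(p)=\varphi_N^{-1}(p)$. A minimal presentation $\rho$ of $N$ is obtained from a minimal generating set of the congruence $\ker\varphi_N$ by omitting all pairs $(z,z')$ with $\varphi_N(z)=\infty$. An outer Betti element of $N$ is a set $B\subseteq \mathsf Z_N(\infty)$ such that (i) for every $i$ for which some $z\in B$ has $z_i>0$, the set $\{z-e_i : z\in B,\ z_i>0\}$ equals $\mathsf Z_N(p)$ for some $p\ne\infty$; and (ii) the graph with vertex set $B$, in which distinct $z,z'$ are adjacent when $z_i>0$ and $z'_i>0$ for some $i$, is connected (in particular $B\neq\emptyset$).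 Put $\eta(N)=b(N)+|\rho|$, where $b(N)$ is the number of outer Betti elements of $N$ and $\rho$ is any minimal presentation of $N$. For a numerical semigroup $S$ (a cofinite submonoid of $\mathbb Z_{\ge0}$), let $\mathsf m(S)$ be its smallest nonzero element, $\mathsf e(S)$ the number of its atoms, and $\mathsf m(S)-\mathsf e(S)$ its embedding codimension; $\eta(S)$ is the cardinality of any minimal presentation of $S$, that is, of any minimal generating set of the kernel congruence of the factorization homomorphism $\mathbb Z_{\ge0}^{\mathsf e(S)}\to S$. Theorem. Let $N$ be a finite partly cancellative nilsemigroup with embedding codimension $r$, and let $e=\mathsf e(N)$. If $r\le 2$, then $\eta(N)\le\binom e2$; if $r=3$, then $\eta(N)\le\binom e2+1$. Likewise, let $S$ be a numerical semigroup with embedding codimension $r$ and let $e=\mathsf e(S)$. If $r\le 2$, then $\eta(S)\le\binom e2$; if $r=3$, then $\eta(S)\le\binom e2+1$. -/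

import Mathlib

/-- The atoms of a commutative monoid: the non-unit elements that are not a sum of two non-units.
For the reduced atomic monoids considered below (numerical semigroups, and finite partly
cancellative nilsemigroups with a non-nil nonzero element) they form the unique minimal generating
set. -/
abbrev Atom (M : Type*) [AddCommMonoid M] : Type _ := {a : M // AddIrreducible a}

/-- Tuples of multiplicities, indexed by the atoms. -/
abbrev Factorization (M : Type*) [AddCommMonoid M] : Type _ := Atom M →₀ ℕ

/-- The factorization homomorphism, sending `z` to the sum of `z a • a` over the atoms `a`. -/
noncomputable def factorizationHom (M : Type*) [AddCommMonoid M] : Factorization M →+ M :=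
  (Finsupp.linearCombination ℕ (fun a : Atom M => (a : M))).toAddMonoidHom

/-- The set of factorizations of `p`. -/
def factorizations {M : Type*} [AddCommMonoid M] (p : M) : Set (Factorization M) :=
  {z | factorizationHom M z = p}

/-- A set of trades is a presentation if the congruence it generates is the kernel of the
factorization homomorphism. -/
def IsPresentation (M : Type*) [AddCommMonoid M]
    (ρ : Set (Factorization M × Factorization M)) : Prop :=
  addConGen (fun z z' => (z, z') ∈ ρ) = AddCon.ker (factorizationHom M)

/-- A presentation none of whose proper subsets is a presentation. -/
def IsMinimalPresentation (M : Type*) [AddCommMonoid M]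
    (ρ : Set (Factorization M × Factorization M)) : Prop :=
  Minimal (IsPresentation M) ρ

/-- Commutative nilsemigroups with identity that are partly cancellative: there is an absorbing
element `nil`, every element other than the identity has a multiple equal to `nil`, and
`a + b = a + c ≠ nil` implies `b = c`. -/
class PartlyCancellativeNilsemigroup (N : Type*) extends AddCommMonoid N where
  /-- The nil element. -/
  nil : N
  nil_ne_zero : nil ≠ 0
  nil_add : ∀ a : N, nil + a = nil
  nilpotent : ∀ a : N, a ≠ 0 → ∃ k : ℕ, k • a = nil
  partly_cancel : ∀ a b c : N, a + b = a + c → a + b ≠ nil → b = c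

namespace PartlyCancellativeNilsemigroup

/-- The number of non-nil elements. -/
noncomputable def multiplicity (N : Type*) [PartlyCancellativeNilsemigroup N] : ℕ :=
  Nat.card {a : N // a ≠ nil}

/-- One more than the number of atoms. -/
noncomputable def embDim (N : Type*) [PartlyCancellativeNilsemigroup N] : ℕ :=
  Nat.card (Atom N) + 1

noncomputable def embCodim (N : Type*) [PartlyCancellativeNilsemigroup N] : ℤ :=
  (multiplicity N : ℤ) - (embDim N : ℤ)

/-- A minimal presentation of a nilsemigroup: a minimal generating set of the kernel congruence,
with the trades between factorizations of the nil omitted. -/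
def IsMinPresentation (N : Type*) [PartlyCancellativeNilsemigroup N]
    (ρ : Set (Factorization N × Factorization N)) : Prop :=
  ∃ σ, IsMinimalPresentation N σ ∧ ρ = {t ∈ σ | factorizationHom N t.1 ≠ nil}

/-- The graph on a set `Z` of factorizations in which distinct `z`, `z'` are adjacent when
their supports meet. -/
def supportGraph {M : Type*} [AddCommMonoid M] (Z : Set (Factorization M)) : SimpleGraph Z where
  Adj z z' := z ≠ z' ∧ ∃ i, 0 < z.1 i ∧ 0 < z'.1 i
  symm := ⟨fun _ _ h => ⟨h.1.symm, h.2.imp fun _ hi => ⟨hi.2, hi.1⟩⟩⟩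
  loopless := ⟨fun _ h => h.1 rfl⟩

/-- The set of all `z - e_i` with `z ∈ Z` and `i` in the support of `z`. -/
def subAtom {M : Type*} [AddCommMonoid M] (Z : Set (Factorization M)) (i : Atom M) :
    Set (Factorization M) :=
  {w | w + Finsupp.single i 1 ∈ Z}

/-- Outer Betti elements (they are nonempty, since connected graphs are). -/
structure IsOuterBetti {N : Type*} [PartlyCancellativeNilsemigroup N]
    (B : Set (Factorization N)) : Prop where
  subset_nil : B ⊆ factorizations nil
  sub_eq : ∀ i : Atom N, (∃ z ∈ B, 0 < z i) → ∃ p : N, p ≠ nil ∧ subAtom B i = factorizations p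
  connected : (supportGraph B).Connected

/-- The number of outer Betti elements. -/
noncomputable def numOuterBetti (N : Type*) [PartlyCancellativeNilsemigroup N] : ℕ∞ :=
  {B : Set (Factorization N) | IsOuterBetti B}.encard

end PartlyCancellativeNilsemigroup

namespace NumericalSemigroup

/-- Numerical semigroups: submonoids of the natural numbers with finite complement. -/
def IsNumerical (S : AddSubmonoid ℕ) : Prop := ((S : Set ℕ)ᶜ).Finite

/-- The smallest nonzero element. -/
noncomputable def multiplicity (S : AddSubmonoid ℕ) : ℕ := sInf {n | n ∈ S ∧ n ≠ 0}

/-- The number of atoms. -/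
noncomputable def embDim (S : AddSubmonoid ℕ) : ℕ := Nat.card (Atom S)

noncomputable def embCodim (S : AddSubmonoid ℕ) : ℤ := (multiplicity S : ℤ) - (embDim S : ℤ)

end NumericalSemigroup

/-!
Fix a well-order on exponent vectors that is compatible with addition, and call a factorization of
a non-nil element canonical if it is the least factorization of that element. The canonical
factorizations form a lower set `D`, a staircase, whose size is the number of non-nil elements that
have a factorization. Its corners, the minimal vectors outside `D`, play the role of the minimal
generators of an initial ideal, and both parts of `η` are bounded by counting them.

* The least element of an outer Betti element is a corner that factors the nil element, and it
  determines the outer Betti element by connectedness (`numOuterBetti_le_corners`).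
* In a minimal presentation the trades between factorizations of non-nil elements form a forest on
  the classes of factorizations linked by common atoms. The cut functions of its edges are linearly
  independent, and a combination of them vanishes as soon as it agrees at every non-nil corner and
  the canonical factorization of the same element
  (`IsMinimalPresentation.encard_le_corners`). So there are at most as many such trades as
  non-nil corners.

Hence `η(N)` is at most the number of corners of a staircase with `1 + n + r` elements that contains
the `n` unit vectors, where `n = e - 1`. Together with the elements of `D` of degree at least two,
of which there are `r`, the corners consist of vectors of degree two, of which there are
`(n + 1).choose 2`, and of vectors of degree at least three all of whose predecessors are among the
`r` elements. There are at most `r` of the latter if `r ≤ 2`, and at most `4` if `r = 3`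
(`exists_cover_of_predecessors_mem`, `corners_encard_le`).

For a numerical semigroup of multiplicity `m`, the order is chosen so that canonical factorizations
use `m` as often as possible. Then `m` does not occur in any corner, and the canonical
factorizations without `m` are in bijection with the Apéry set of `m`, which has `m` elements; so
the same count applies.
-/

/-! ### Corners of finite staircases -/

section Staircase

variable {ι : Type*}

/-- The corners of a set `D` of exponent vectors: the vectors outside `D` all of whose immediate
predecessors lie in `D`. If `D` is a lower set, these are the minimal elements of its
complement. -/
def corners (D : Set (ι →₀ ℕ)) : Set (ι →₀ ℕ) :=
  {z | z ∉ D ∧ ∀ w i, w + Finsupp.single i 1 = z → w ∈ D}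

theorem exists_add_single_eq {z : ι →₀ ℕ} {i : ι} (h : 0 < z i) :
    ∃ w, w + Finsupp.single i 1 = z :=
  ⟨z - Finsupp.single i 1, tsub_add_cancel_of_le (Finsupp.single_le_iff.mpr h)⟩

theorem exists_add_single_of_ne_zero {z : ι →₀ ℕ} (h : z ≠ 0) :
    ∃ w i, w + Finsupp.single i 1 = z := by
  obtain ⟨i, hi⟩ := Finsupp.ne_iff.mp h
  obtain ⟨w, hw⟩ := exists_add_single_eq (Nat.pos_of_ne_zero hi)
  exact ⟨w, i, hw⟩

theorem exists_eq_single_of_degree_eq_one {z : ι →₀ ℕ} (h : z.degree = 1) :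
    ∃ i, z = Finsupp.single i 1 := by
  obtain ⟨w, i, rfl⟩ := exists_add_single_of_ne_zero (z := z) (by rintro rfl; simp at h)
  refine ⟨i, ?_⟩
  have : w = 0 := w.degree_eq_zero_iff.mp (by simpa using h)
  simp [this]

theorem exists_eq_single_add_single_of_degree_eq_two {z : ι →₀ ℕ} (h : z.degree = 2) :
    ∃ i j, z = Finsupp.single i 1 + Finsupp.single j 1 := by
  obtain ⟨w, i, rfl⟩ := exists_add_single_of_ne_zero (z := z) (by rintro rfl; simp at h)
  obtain ⟨j, rfl⟩ := exists_eq_single_of_degree_eq_one (z := w) (by simpa using h)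
  exact ⟨j, i, rfl⟩

/-- A vector with two different predecessors is their supremum, so it is determined by the
unordered pair they form. -/
theorem sup_eq_of_add_single_eq {u v z : ι →₀ ℕ} {i j : ι} (hij : i ≠ j)
    (hu : u + Finsupp.single i 1 = z) (hv : v + Finsupp.single j 1 = z) : u ⊔ v = z := by
  classical
  ext k
  have h1 := DFunLike.congr_fun hu k
  have h2 := DFunLike.congr_fun hv k
  simp only [Finsupp.add_apply, Finsupp.single_apply, Finsupp.sup_apply] at h1 h2 ⊢
  have hle : ¬(i = k ∧ j = k) := fun h => hij (h.1.trans h.2.symm)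
  split_ifs at h1 h2 <;> first | omega | exact absurd ⟨‹_›, ‹_›⟩ hle

/-- The vectors of degree at least three all of whose predecessors lie in a finite set `X`: those
that are multiples of a unit vector are determined by their only predecessor, which is again such a
multiple, and each of the others by a pair of predecessors that are not both such multiples. -/
theorem exists_cover_of_predecessors_mem (X : Finset (ι →₀ ℕ)) :
    ∃ G : Finset (ι →₀ ℕ), ∃ p ≤ X.card,
      (∀ z : ι →₀ ℕ, 3 ≤ z.degree → (∀ w i, w + Finsupp.single i 1 = z → w ∈ X) → z ∈ G) ∧
      G.card ≤ p + (X.card.choose 2 - p.choose 2) := by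
  classical
  let P : Finset (ι →₀ ℕ) := X.filter fun x => ∃ i n, x = Finsupp.single i n
  have hPX : P ⊆ X := Finset.filter_subset _ _
  let g : (ι →₀ ℕ) → (ι →₀ ℕ) :=
    Finsupp.mapRange (fun n => if n = 0 then 0 else n + 1) (by simp)
  refine ⟨P.image g ∪ (X.powersetCard 2 \ P.powersetCard 2).image fun s => s.sup id, P.card,
    Finset.card_le_card hPX, fun z hz hX => ?_, (Finset.card_union_le _ _).trans ?_⟩
  · rw [Finset.mem_union, Finset.mem_image, Finset.mem_image]
    by_cases hp : ∃ i n, z = Finsupp.single i n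
    · obtain ⟨i, n, rfl⟩ := hp
      rw [Finsupp.degree_single] at hz
      obtain ⟨k, rfl⟩ : ∃ k, n = k + 2 := ⟨n - 2, by omega⟩
      refine Or.inl ⟨Finsupp.single i (k + 1), Finset.mem_filter.mpr ⟨hX _ i ?_, i, _, rfl⟩, ?_⟩
      · rw [← Finsupp.single_add]
      · simp only [g, Finsupp.mapRange_single]
        rfl
    · right
      obtain ⟨u, i, hu⟩ := exists_add_single_of_ne_zero (z := z) (by rintro rfl; simp at hz)
      obtain ⟨j, hji, hj⟩ : ∃ j, j ≠ i ∧ 0 < z j := by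
        by_contra! hcon
        refine hp ⟨i, z i, ?_⟩
        ext k
        by_cases hk : k = i
        · simp [hk]
        · rw [Finsupp.single_eq_of_ne hk]
          simpa using hcon k hk
      obtain ⟨v, hv⟩ := exists_add_single_eq hj
      have huv : u ≠ v := by
        rintro rfl
        have := add_left_cancel (hu.trans hv.symm)
        exact hji ((Finsupp.single_left_injective one_ne_zero) this).symm
      refine ⟨{u, v}, Finset.mem_sdiff.mpr ⟨Finset.mem_powersetCard.mpr
        ⟨?_, Finset.card_pair huv⟩, fun hmem => ?_⟩, ?_⟩
      · intro x hx
        rcases Finset.mem_insert.mp hx with rfl | hx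
        · exact hX _ _ hu
        · rw [Finset.mem_singleton.mp hx]
          exact hX _ _ hv
      · have hsub := (Finset.mem_powersetCard.mp hmem).1
        obtain ⟨-, a, n, rfl⟩ := Finset.mem_filter.mp (hsub (Finset.mem_insert_self u {v}))
        obtain ⟨-, b, m, rfl⟩ := Finset.mem_filter.mp
          (hsub (Finset.mem_insert_of_mem (Finset.mem_singleton_self v)))
        -- If both predecessors are multiples of unit vectors, then `z` is a sum of two
        -- different unit vectors.
        have e1 := DFunLike.congr_fun (hu.trans hv.symm) i
        have e2 := DFunLike.congr_fun (hu.trans hv.symm) j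
        have hd := congrArg Finsupp.degree hu
        have hd' := congrArg Finsupp.degree hv
        simp only [map_add, Finsupp.degree_single] at hd hd'
        simp only [Finsupp.add_apply, Finsupp.single_apply] at e1 e2
        simp only [hji, hji.symm, if_true, if_false] at e1 e2
        split_ifs at e1 e2 <;> omega
      · simpa using sup_eq_of_add_single_eq hji.symm hu hv
  · refine add_le_add Finset.card_image_le (Finset.card_image_le.trans ?_)
    rw [Finset.card_sdiff_of_subset (Finset.powersetCard_mono hPX), Finset.card_powersetCard,
      Finset.card_powersetCard]

/-- A lower set with at most `1 + n + r` elements that contains the `n` unit vectors has at most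
`(n + 1).choose 2` corners if `r ≤ 2`, and at most one more if `r = 3`: adding the elements of
degree at least two to the corners gives a set made up of the vectors of degree two and of the
vectors counted in `exists_cover_of_predecessors_mem`. -/
theorem corners_encard_le {D : Set (ι →₀ ℕ)} {A : Finset ι} {r : ℕ} (hfin : D.Finite)
    (hlower : ∀ w i, w + Finsupp.single i 1 ∈ D → w ∈ D)
    (hsupp : ∀ z ∈ D, z.support ⊆ A) (hzero : 0 ∈ D) (hsingle : ∀ i ∈ A, Finsupp.single i 1 ∈ D)
    (hcard : D.ncard ≤ 1 + A.card + r) :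
    (r ≤ 2 → {z ∈ corners D | z.support ⊆ A}.encard ≤ ((A.card + 1).choose 2 : ℕ)) ∧
    (r = 3 → {z ∈ corners D | z.support ⊆ A}.encard ≤ ((A.card + 1).choose 2 + 1 : ℕ)) := by
  classical
  obtain ⟨D, rfl⟩ := hfin.exists_finset_coe
  rw [Set.ncard_coe_finset] at hcard
  set C := {z ∈ corners (D : Set (ι →₀ ℕ)) | z.support ⊆ A}
  let X := D.filter fun z => 2 ≤ z.degree
  -- The elements of `D` of degree less than two are zero and the unit vectors.
  have hX : X.card ≤ r := by
    have hsub : insert 0 (A.image fun i => Finsupp.single i 1) ∪ X ⊆ D := by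
      refine Finset.union_subset (Finset.insert_subset hzero ?_) (Finset.filter_subset _ _)
      exact Finset.image_subset_iff.mpr hsingle
    have hdisj : Disjoint (insert 0 (A.image fun i => Finsupp.single i 1)) X := by
      rw [Finset.disjoint_left]
      intro z hz hzX
      have := (Finset.mem_filter.mp hzX).2
      rcases Finset.mem_insert.mp hz with rfl | hz
      · simp at this
      · obtain ⟨i, -, rfl⟩ := Finset.mem_image.mp hz
        simp at this
    have h := Finset.card_le_card hsub
    rw [Finset.card_union_of_disjoint hdisj, Finset.card_insert_of_notMem (by simp),
      Finset.card_image_of_injective _ (Finsupp.single_left_injective one_ne_zero)] at h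
    omega
  obtain ⟨G, p, hp, hG, hGcard⟩ := exists_cover_of_predecessors_mem X
  let Q : Finset (ι →₀ ℕ) := A.sym2.image fun s =>
    Sym2.lift ⟨fun i j => Finsupp.single i 1 + Finsupp.single j 1, fun _ _ => add_comm _ _⟩ s
  have hcover : ∀ z : ι →₀ ℕ, z.support ⊆ A → 2 ≤ z.degree →
      (∀ w i, w + Finsupp.single i 1 = z → w ∈ D) → z ∈ Q ∪ G := by
    intro z hzA hz hw
    rw [Finset.mem_union]
    rcases hz.lt_or_eq with hz | hz
    · refine Or.inr (hG z hz fun w i hwi => Finset.mem_filter.mpr ⟨hw w i hwi, ?_⟩)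
      rw [← hwi, map_add, Finsupp.degree_single] at hz
      omega
    · obtain ⟨i, j, rfl⟩ := exists_eq_single_add_single_of_degree_eq_two hz.symm
      refine Or.inl (Finset.mem_image.mpr ⟨s(i, j), ?_, rfl⟩)
      rw [Finset.mk_mem_sym2_iff]
      exact ⟨hzA (by simp), hzA (by simp)⟩
  have hCcover : C ∪ X ⊆ ↑(Q ∪ G) := by
    rintro z (⟨⟨hzD, hz⟩, hzA⟩ | hz)
    · refine hcover z hzA ?_ hz
      by_contra! hlt
      interval_cases h : z.degree
      · rw [Finsupp.degree_eq_zero_iff] at h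
        exact hzD (h ▸ hzero)
      · obtain ⟨i, rfl⟩ := exists_eq_single_of_degree_eq_one h
        exact hzD (hsingle i (hzA (by simp)))
    · obtain ⟨hzD, hz⟩ := Finset.mem_filter.mp hz
      exact hcover z (hsupp z hzD) hz fun w i hw => hlower w i (hw ▸ hzD)
  have hCfin : C.Finite :=
    (Finset.finite_toSet _).subset (Set.subset_union_left.trans hCcover)
  obtain ⟨C', hC'⟩ := hCfin.exists_finset_coe
  rw [← hC'] at hCcover ⊢
  rw [← Finset.coe_union, Finset.coe_subset] at hCcover
  have hdisj : Disjoint C' X := by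
    rw [Finset.disjoint_left]
    intro z hz hzX
    have hzC : z ∈ C := hC' ▸ Finset.mem_coe.mpr hz
    exact hzC.1.1 (Finset.mem_filter.mp hzX).1
  have hle : C'.card + X.card ≤ (A.card + 1).choose 2 + (p + (X.card.choose 2 - p.choose 2)) := by
    rw [← Finset.card_union_of_disjoint hdisj]
    refine ((Finset.card_le_card hCcover).trans (Finset.card_union_le _ _)).trans
      (add_le_add ?_ hGcard)
    exact Finset.card_image_le.trans_eq (Finset.card_sym2 A)
  rw [Set.encard_coe_eq_coe_finsetCard, Nat.cast_le, Nat.cast_le]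
  generalize X.card = x at *
  generalize (A.card + 1).choose 2 = b at *
  constructor <;> intro hr
  · have : x ≤ 2 := hX.trans hr
    interval_cases x <;> interval_cases p <;> simp [Nat.choose] at hle <;> omega
  · have : x ≤ 3 := hX.trans hr.le
    interval_cases x <;> interval_cases p <;> simp [Nat.choose] at hle <;> omega

end Staircase

/-! ### Orders on factorizations -/

section Order

variable {ι : Type*}

/-- Every weight can be refined to a well-order on exponent vectors that is compatible with
addition. -/
theorem exists_isWellOrder_refining (wt : (ι →₀ ℕ) →+ ℕ) :
    ∃ lt : (ι →₀ ℕ) → (ι →₀ ℕ) → Prop, IsWellOrder _ lt ∧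
      (∀ x y z, lt x y → lt (x + z) (y + z)) ∧ ∀ x y, wt x < wt y → lt x y := by
  classical
  let : LinearOrder ι := IsWellOrder.linearOrder WellOrderingRel
  have : WellFoundedLT ι := ⟨(WellOrderingRel.isWellOrder (α := ι)).wf⟩
  let key : (ι →₀ ℕ) → ℕ ×ₗ Colex (ι →₀ ℕ) := fun z => toLex (wt z, toColex z)
  have hkey : Function.Injective key := fun x y h =>
    toColex.injective (congrArg (fun a => (ofLex a).2) h)
  have hadd : ∀ x z, key (x + z) = key x + key z := fun x z => by
    simp only [key, map_add]
    rfl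
  refine ⟨fun x y => key x < key y, ?_, fun x y z h => ?_, fun x y h => ?_⟩
  · exact RelEmbedding.isWellOrder (r := InvImage (· < ·) key) (s := (· < ·))
      ⟨⟨key, hkey⟩, Iff.rfl⟩
  · change key _ < key _
    rw [hadd, hadd]
    exact add_lt_add_left h _
  · exact Prod.Lex.toLex_lt_toLex.mpr (Or.inl h)

end Order

/-! ### Canonical factorizations and minimal presentations -/

section Canonical

variable {M : Type*} [AddCommMonoid M]

/-- The factorizations of elements outside `ν` that are least, with respect to `lt`, among all
factorizations of the same element. Taking `ν` empty covers cancellative monoids, and taking for `ν`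
the set of the nil element covers partly cancellative nilsemigroups. -/
def canonicalFactorizations (ν : Set M) (lt : Factorization M → Factorization M → Prop) :
    Set (Factorization M) :=
  {z | factorizationHom M z ∉ ν ∧
    ∀ w, factorizationHom M w = factorizationHom M z → ¬ lt w z}

theorem factorizationHom_single (a : Atom M) (n : ℕ) :
    factorizationHom M (Finsupp.single a n) = n • (a : M) := by
  simp [factorizationHom]

variable {ν : Set M} {lt : Factorization M → Factorization M → Prop}

theorem canonicalFactorizations_injOn [IsWellOrder _ lt] :
    Set.InjOn (factorizationHom M) (canonicalFactorizations ν lt) := by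
  intro x hx y hy hxy
  by_contra hne
  rcases trichotomous_of lt x y with h | h | h
  · exact hy.2 x hxy h
  · exact hne h
  · exact hx.2 y hxy.symm h

theorem mem_canonicalFactorizations_of_add_single (hν : ∀ a b : M, a ∈ ν → a + b ∈ ν)
    (hadd : ∀ x y z, lt x y → lt (x + z) (y + z)) {w : Factorization M} {i : Atom M}
    (h : w + Finsupp.single i 1 ∈ canonicalFactorizations ν lt) :
    w ∈ canonicalFactorizations ν lt := by
  refine ⟨fun hw => h.1 ?_, fun x hx hlt => h.2 (x + Finsupp.single i 1) ?_ (hadd _ _ _ hlt)⟩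
  · rw [map_add]
    exact hν _ _ hw
  · rw [map_add, map_add, hx]

/-- In a monoid whose only unit is zero, an atom has no factorization other than the obvious
one. -/
theorem eq_single_of_factorizationHom_eq (hunit : ∀ a : M, IsAddUnit a → a = 0) {a : Atom M}
    {z : Factorization M} (h : factorizationHom M z = a) : z = Finsupp.single a 1 := by
  have ha : ∀ b : Atom M, (b : M) ≠ 0 := fun b hb => b.2.not_isAddUnit (hb ▸ isAddUnit_zero)
  have hz : z ≠ 0 := by
    rintro rfl
    exact ha a (by simpa using h.symm)
  obtain ⟨w, i, rfl⟩ := exists_add_single_of_ne_zero hz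
  rw [map_add, factorizationHom_single, one_smul] at h
  have hw : factorizationHom M w = 0 := by
    rcases a.2.isAddUnit_or_isAddUnit h.symm with h' | h'
    · exact hunit _ h'
    · exact absurd (hunit _ h') (ha i)
  have hw0 : w = 0 := by
    by_contra hne
    obtain ⟨v, j, rfl⟩ := exists_add_single_of_ne_zero hne
    rw [map_add, factorizationHom_single, one_smul, add_comm] at hw
    exact j.2.not_isAddUnit (IsAddUnit.of_add_eq_zero _ hw)
  rw [hw, zero_add] at h
  rw [hw0, zero_add, Subtype.ext h]

theorem eq_zero_of_factorizationHom_eq_zero {z : Factorization M}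
    (h : factorizationHom M z = 0) : z = 0 := by
  by_contra hne
  obtain ⟨v, j, rfl⟩ := exists_add_single_of_ne_zero hne
  rw [map_add, factorizationHom_single, one_smul, add_comm] at h
  exact j.2.not_isAddUnit (IsAddUnit.of_add_eq_zero _ h)

theorem zero_mem_canonicalFactorizations [IsWellOrder _ lt] (h0 : (0 : M) ∉ ν) :
    0 ∈ canonicalFactorizations ν lt := by
  refine ⟨by simpa using h0, fun w hw => ?_⟩
  rw [eq_zero_of_factorizationHom_eq_zero (hw.trans (map_zero _))]
  exact irrefl_of lt 0

theorem single_mem_canonicalFactorizations [IsWellOrder _ lt]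
    (hunit : ∀ a : M, IsAddUnit a → a = 0) {a : Atom M} (ha : (a : M) ∉ ν) :
    Finsupp.single a 1 ∈ canonicalFactorizations ν lt := by
  have h : factorizationHom M (Finsupp.single a 1) = a := by
    rw [factorizationHom_single, one_smul]
  refine ⟨by rwa [h], fun w hw => ?_⟩
  rw [eq_single_of_factorizationHom_eq hunit (hw.trans h)]
  exact irrefl_of lt _

theorem IsPresentation.factorizationHom_eq {σ : Set (Factorization M × Factorization M)}
    (hσ : IsPresentation M σ) {t : Factorization M × Factorization M} (ht : t ∈ σ) :
    factorizationHom M t.1 = factorizationHom M t.2 := by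
  have h : addConGen (fun z z' => (z, z') ∈ σ) t.1 t.2 := AddConGen.Rel.of _ _ ht
  rw [hσ] at h
  exact h

/-- The congruence generated by all trades of `σ` but `t`. -/
noncomputable def conWithout (σ : Set (Factorization M × Factorization M))
    (t : Factorization M × Factorization M) : AddCon (Factorization M) :=
  addConGen fun z z' => (z, z') ∈ σ ∧ (z, z') ≠ t

/-- No trade of a minimal presentation follows from the others. -/
theorem IsMinimalPresentation.not_conWithout {σ : Set (Factorization M × Factorization M)}
    (hσ : IsMinimalPresentation M σ) {t : Factorization M × Factorization M} (ht : t ∈ σ) :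
    ¬ conWithout σ t t.1 t.2 := by
  intro h
  have hpres : IsPresentation M (σ \ {t}) := by
    have hdiff : addConGen (fun z z' => (z, z') ∈ σ \ {t}) = conWithout σ t := rfl
    have hσ' := hσ.1
    rw [IsPresentation] at hσ' ⊢
    rw [hdiff, ← hσ']
    refine le_antisymm (AddCon.addConGen_le.mpr fun x y hxy => AddConGen.Rel.of _ _ hxy.1)
      (AddCon.addConGen_le.mpr fun x y hxy => ?_)
    by_cases hne : (x, y) = t
    · subst hne
      exact h
    · exact AddConGen.Rel.of _ _ ⟨hxy, hne⟩
  exact (hσ.2 hpres Set.sdiff_subset ht).2 rfl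

/-- A trade between factorizations of `p` is not needed to relate factorizations of an element that
does not have `p` as a summand. -/
theorem IsPresentation.conWithout_or {σ : Set (Factorization M × Factorization M)}
    (hσ : IsPresentation M σ) (t : Factorization M × Factorization M)
    {x y : Factorization M} (hxy : factorizationHom M x = factorizationHom M y) :
    (∃ s, factorizationHom M x = factorizationHom M t.1 + s) ∨ conWithout σ t x y := by
  let c : AddCon (Factorization M) :=
    { r := fun x y => factorizationHom M x = factorizationHom M y ∧
        ((∃ s, factorizationHom M x = factorizationHom M t.1 + s) ∨ conWithout σ t x y)
      iseqv := by
        refine ⟨fun x => ⟨rfl, Or.inr ((conWithout σ t).refl x)⟩, fun {x y} h => ⟨h.1.symm, ?_⟩,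
          fun {x y z} h h' => ⟨h.1.trans h'.1, ?_⟩⟩
        · exact h.2.imp (fun hs => h.1 ▸ hs) (conWithout σ t).symm
        · rcases h.2 with hs | hs
          · exact Or.inl hs
          · rcases h'.2 with hs' | hs'
            · exact Or.inl (h.1 ▸ hs')
            · exact Or.inr ((conWithout σ t).trans hs hs')
      add' := by
        intro w x y z h h'
        refine ⟨by rw [map_add, map_add, h.1, h'.1], ?_⟩
        rw [map_add]
        rcases h.2 with ⟨s, hs⟩ | hs
        · exact Or.inl ⟨s + factorizationHom M y, by rw [hs, add_assoc]⟩
        · rcases h'.2 with ⟨s', hs'⟩ | hs'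
          · exact Or.inl ⟨factorizationHom M w + s', by rw [hs', add_left_comm]⟩
          · exact Or.inr ((conWithout σ t).add hs hs') }
  have hle : AddCon.ker (factorizationHom M) ≤ c := by
    rw [← show addConGen (fun z z' => (z, z') ∈ σ) = AddCon.ker (factorizationHom M) from hσ]
    refine AddCon.addConGen_le.mpr fun x y h => ⟨hσ.factorizationHom_eq h, ?_⟩
    by_cases hne : (x, y) = t
    · exact Or.inl ⟨0, by rw [← hne, add_zero]⟩
    · exact Or.inr (AddConGen.Rel.of _ _ ⟨h, hne⟩)
  exact (hle hxy).2

/-- Two factorizations with a common atom are related by trades between factorizations of proper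
summands. -/
theorem IsPresentation.conWithout_of_common_atom {σ : Set (Factorization M × Factorization M)}
    (hσ : IsPresentation M σ)
    (hcancel : ∀ a b c : M, a + b = a + c → a + b ∉ ν → b = c)
    {t : Factorization M × Factorization M} (htν : factorizationHom M t.1 ∉ ν)
    {u v : Factorization M} {i : Atom M}
    (hu : factorizationHom M (u + Finsupp.single i 1) = factorizationHom M t.1)
    (hv : factorizationHom M (v + Finsupp.single i 1) = factorizationHom M t.1) :
    conWithout σ t (u + Finsupp.single i 1) (v + Finsupp.single i 1) := by
  rw [map_add, factorizationHom_single, one_smul, add_comm] at hu hv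
  have huv := hcancel _ _ _ (hu.trans hv.symm) (hu ▸ htν)
  rcases hσ.conWithout_or t huv with ⟨s, hs⟩ | h
  · exfalso
    rw [hs, add_left_comm, ← add_zero (factorizationHom M t.1), add_assoc, zero_add] at hu
    have h0 := hcancel _ _ _ hu (by rw [hu, add_zero]; exact htν)
    exact i.2.not_isAddUnit (IsAddUnit.of_add_eq_zero _ h0)
  · exact (conWithout σ t).add h ((conWithout σ t).refl _)

/-- A function on factorizations that does not distinguish factorizations of the same element with
a common atom is constant on the factorizations of each element outside `ν`, provided it takes the
same value at every corner and at the corresponding canonical factorization. -/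
theorem apply_eq_of_corners [IsWellOrder _ lt] {k : Type*}
    (hν : ∀ a b : M, a ∈ ν → a + b ∈ ν) (hadd : ∀ x y z, lt x y → lt (x + z) (y + z))
    {f : Factorization M → k}
    (hf : ∀ u v i, factorizationHom M u = factorizationHom M v →
      f (u + Finsupp.single i 1) = f (v + Finsupp.single i 1))
    (hcorner : ∀ z ∈ corners (canonicalFactorizations ν lt), factorizationHom M z ∉ ν →
      ∀ y ∈ canonicalFactorizations ν lt, factorizationHom M y = factorizationHom M z → f z = f y)
    {y : Factorization M} (hy : y ∈ canonicalFactorizations ν lt) (x : Factorization M)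
    (hxy : factorizationHom M x = factorizationHom M y) : f x = f y := by
  have hwf : WellFounded lt := IsWellFounded.wf
  induction x using hwf.induction with
  | _ x ih =>
    have hxν : factorizationHom M x ∉ ν := hxy ▸ hy.1
    by_cases hx : x ∈ canonicalFactorizations ν lt
    · rw [canonicalFactorizations_injOn hx hy hxy]
    by_cases hxc : x ∈ corners (canonicalFactorizations ν lt)
    · exact hcorner x hxc hxν y hy hxy.symm
    obtain ⟨w, i, rfl, hw⟩ : ∃ w i, w + Finsupp.single i 1 = x ∧
        w ∉ canonicalFactorizations ν lt := by
      by_contra! hcon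
      exact hxc ⟨hx, hcon⟩
    obtain ⟨v, hv, hlt⟩ : ∃ v, factorizationHom M v = factorizationHom M w ∧ lt v w := by
      by_contra! hcon
      refine hw ⟨fun hwν => hxν ?_, hcon⟩
      rw [map_add]
      exact hν _ _ hwν
    rw [hf w v i hv.symm]
    refine ih _ (hadd _ _ _ hlt) ?_
    rw [← hxy, map_add, map_add, hv]

theorem exists_mem_canonicalFactorizations [IsWellOrder _ lt] {x : Factorization M}
    (hx : factorizationHom M x ∉ ν) :
    ∃ y ∈ canonicalFactorizations ν lt, factorizationHom M y = factorizationHom M x := by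
  have hwf : WellFounded lt := IsWellFounded.wf
  obtain ⟨y, hy, hmin⟩ := hwf.has_min {y | factorizationHom M y = factorizationHom M x} ⟨x, rfl⟩
  rw [Set.mem_ofPred_eq] at hy
  exact ⟨y, ⟨hy ▸ hx, fun w hw => hmin w (hw.trans hy)⟩, hy⟩

/-- A minimal presentation has at most as many trades outside `ν` as there are corners outside `ν`.
A trade `t` of a minimal presentation separates the factorizations of its element into those that
can be reached from `t.1` without using `t`, and the others; the indicator function of the first
part is constant along every trade but `t`. By `apply_eq_of_corners` these functions are linearly
independent as functions of the corners. -/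
theorem IsMinimalPresentation.encard_le_corners [IsWellOrder _ lt]
    (hν : ∀ a b : M, a ∈ ν → a + b ∈ ν) (hadd : ∀ x y z, lt x y → lt (x + z) (y + z))
    (hcancel : ∀ a b c : M, a + b = a + c → a + b ∉ ν → b = c)
    {σ : Set (Factorization M × Factorization M)} (hσ : IsMinimalPresentation M σ) :
    {t ∈ σ | factorizationHom M t.1 ∉ ν}.encard ≤
      {z ∈ corners (canonicalFactorizations ν lt) | factorizationHom M z ∉ ν}.encard := by
  classical
  set K := {z ∈ corners (canonicalFactorizations ν lt) | factorizationHom M z ∉ ν}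
  set ρ := {t ∈ σ | factorizationHom M t.1 ∉ ν}
  by_cases hfin : K.Finite
  swap
  · rw [Set.Infinite.encard_eq hfin]
    exact le_top
  have := hfin.to_subtype
  let := Fintype.ofFinite K
  choose! can hcan hcan_eq using
    fun (x : Factorization M) => exists_mem_canonicalFactorizations (ν := ν) (lt := lt) (x := x)
  let f : ρ → Factorization M → ℚ := fun t x =>
    if factorizationHom M x = factorizationHom M t.1.1 ∧ conWithout σ t.1 t.1.1 x then 1 else 0
  have hf_atom : ∀ (t : ρ) u v i, factorizationHom M u = factorizationHom M v →
      f t (u + Finsupp.single i 1) = f t (v + Finsupp.single i 1) := by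
    intro t u v i huv
    have huv' : factorizationHom M (u + Finsupp.single i 1) =
        factorizationHom M (v + Finsupp.single i 1) := by rw [map_add, map_add, huv]
    simp only [f]
    rw [← huv']
    by_cases hu : factorizationHom M (u + Finsupp.single i 1) = factorizationHom M t.1.1
    · have hc := hσ.1.conWithout_of_common_atom hcancel t.2.2 hu (huv' ▸ hu)
      have : conWithout σ t.1 t.1.1 (u + Finsupp.single i 1) ↔
          conWithout σ t.1 t.1.1 (v + Finsupp.single i 1) :=
        ⟨fun h => (conWithout σ t.1).trans h hc,
          fun h => (conWithout σ t.1).trans h ((conWithout σ t.1).symm hc)⟩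
      rw [this]
    · rw [if_neg fun h => hu h.1, if_neg fun h => hu h.1]
  have hf_trade : ∀ t s : ρ, s ≠ t → f t s.1.1 = f t s.1.2 := by
    intro t s hst
    have heq := hσ.1.factorizationHom_eq s.2.1
    have hc : conWithout σ t.1 s.1.1 s.1.2 :=
      AddConGen.Rel.of _ _ ⟨s.2.1, fun h => hst (Subtype.ext h)⟩
    have : conWithout σ t.1 t.1.1 s.1.1 ↔ conWithout σ t.1 t.1.1 s.1.2 :=
      ⟨fun h => (conWithout σ t.1).trans h hc,
        fun h => (conWithout σ t.1).trans h ((conWithout σ t.1).symm hc)⟩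
    simp only [f]
    rw [← heq, this]
  have hf_self : ∀ t : ρ, f t t.1.1 - f t t.1.2 = 1 := by
    intro t
    have h1 : f t t.1.1 = 1 := if_pos ⟨rfl, (conWithout σ t.1).refl _⟩
    have h2 : f t t.1.2 = 0 := if_neg fun h => hσ.not_conWithout t.2.1 h.2
    rw [h1, h2, sub_zero]
  let F : ρ → K → ℚ := fun t z => f t z.1 - f t (can z.1)
  have hli : LinearIndependent ℚ F := by
    rw [linearIndependent_iff']
    intro s g hg t ht
    let h : Factorization M → ℚ := fun x => ∑ i ∈ s, g i * f i x
    have hconst : ∀ y ∈ canonicalFactorizations ν lt, ∀ x,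
        factorizationHom M x = factorizationHom M y → h x = h y := by
      intro y hy x hxy
      refine apply_eq_of_corners hν hadd (fun u v i huv => ?_) (fun z hz hzν y hy hyz => ?_)
        hy x hxy
      · exact Finset.sum_congr rfl fun j _ => by rw [hf_atom j u v i huv]
      · have hyc : y = can z :=
          canonicalFactorizations_injOn hy (hcan z hzν) (hyz.trans (hcan_eq z hzν).symm)
        have h0 := congrFun hg ⟨z, hz, hzν⟩
        simp only [Finset.sum_apply, Pi.smul_apply, smul_eq_mul, F, mul_sub,
          Finset.sum_sub_distrib, Pi.zero_apply] at h0
        rw [hyc]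
        exact sub_eq_zero.mp h0
    have htσ := hσ.1.factorizationHom_eq t.2.1
    have hy := hcan t.1.1 t.2.2
    have hy' := hcan_eq t.1.1 t.2.2
    have hval : h t.1.1 - h t.1.2 = 0 := by
      rw [hconst _ hy _ hy'.symm, hconst _ hy t.1.2 (htσ.symm.trans hy'.symm), sub_self]
    have hsum : h t.1.1 - h t.1.2 = g t := by
      simp only [h]
      rw [← Finset.sum_sub_distrib, Finset.sum_eq_single_of_mem t ht]
      · rw [← mul_sub, hf_self, mul_one]
      · intro i _ hit
        rw [hf_trade i t hit.symm, sub_self]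
    rw [← hsum, hval]
  have := hli.finite
  let := Fintype.ofFinite ρ
  have hcard := hli.fintype_card_le_finrank
  rw [Module.finrank_fintype_fun_eq_card] at hcard
  rw [← Set.coe_fintypeCard, ← Set.coe_fintypeCard]
  exact_mod_cast hcard

end Canonical

/-! ### Nilsemigroups -/

namespace PartlyCancellativeNilsemigroup

variable {N : Type*} [PartlyCancellativeNilsemigroup N]

theorem eq_zero_of_isAddUnit (a : N) (ha : IsAddUnit a) : a = 0 := by
  by_contra hne
  obtain ⟨b, hb⟩ := ha.exists_neg
  obtain ⟨k, hk⟩ := nilpotent a hne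
  refine nil_ne_zero (N := N) ?_
  rw [← nil_add (k • b), ← hk, ← smul_add, hb, smul_zero]

theorem atom_ne_nil (a : Atom N) : (a : N) ≠ nil := by
  intro h
  have hunit : IsAddUnit (nil : N) := by
    rcases a.2.isAddUnit_or_isAddUnit (a := nil) (b := nil) (by rw [h, nil_add]) with h' | h' <;>
      exact h'
  exact nil_ne_zero (eq_zero_of_isAddUnit _ hunit)

/-- Different outer Betti elements are disjoint: from a common element, connectedness leads to all
others, since `subAtom` is determined by any of its elements. -/
theorem IsOuterBetti.subset_of_mem {B B' : Set (Factorization N)} (hB : IsOuterBetti B)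
    (hB' : IsOuterBetti B') {z : Factorization N} (hz : z ∈ B) (hz' : z ∈ B') : B ⊆ B' := by
  have hstep : ∀ x y : B, (supportGraph B).Adj x y → (x : Factorization N) ∈ B' →
      (y : Factorization N) ∈ B' := by
    rintro x y ⟨-, i, hxi, hyi⟩ hx
    obtain ⟨p, -, hp⟩ := hB.sub_eq i ⟨x, x.2, hxi⟩
    obtain ⟨p', -, hp'⟩ := hB'.sub_eq i ⟨x, hx, hxi⟩
    obtain ⟨u, hu⟩ := exists_add_single_eq hxi
    obtain ⟨v, hv⟩ := exists_add_single_eq hyi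
    have hup : u ∈ factorizations p := hp ▸ (show u + Finsupp.single i 1 ∈ B from hu ▸ x.2)
    have hup' : u ∈ factorizations p' := hp' ▸ (show u + Finsupp.single i 1 ∈ B' from hu ▸ hx)
    have hvp : v ∈ factorizations p := hp ▸ (show v + Finsupp.single i 1 ∈ B from hv ▸ y.2)
    have hpp' : p = p' := hup.symm.trans hup'
    have hvB' : v ∈ subAtom B' i := hp' ▸ hpp' ▸ hvp
    exact hv ▸ hvB'
  intro y hy
  obtain ⟨w⟩ := hB.connected.preconnected ⟨z, hz⟩ ⟨y, hy⟩
  suffices h : ∀ a b : B, (supportGraph B).Walk a b → (a : Factorization N) ∈ B' →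
      (b : Factorization N) ∈ B' from h _ _ w hz'
  intro a b w
  induction w with
  | nil => exact id
  | cons hadj _ ih => exact fun ha => ih (hstep _ _ hadj ha)

/-- The least element of an outer Betti element is a corner, and it determines the outer Betti
element. -/
theorem numOuterBetti_le_corners {lt : Factorization N → Factorization N → Prop}
    [IsWellOrder _ lt] (hadd : ∀ x y z, lt x y → lt (x + z) (y + z)) :
    numOuterBetti N ≤
      {z ∈ corners (canonicalFactorizations {(nil : N)} lt) | factorizationHom N z = nil}.encard := by
  have hwf : WellFounded lt := IsWellFounded.wf
  have hmin : ∀ B : Set (Factorization N), IsOuterBetti B → ∃ z ∈ B, ∀ w ∈ B, ¬ lt w z :=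
    fun B hB => hwf.has_min B (Set.nonempty_coe_sort.mp hB.connected.nonempty)
  choose! least hleast hleast_min using hmin
  refine Set.encard_le_encard_of_injOn (f := least) (fun B hB => ?_) fun B hB B' hB' h => ?_
  · have hB : IsOuterBetti B := hB
    have hnil : factorizationHom N (least B) = nil := hB.subset_nil (hleast B hB)
    refine ⟨⟨fun h => h.1 hnil, fun w i hw => ?_⟩, hnil⟩
    have hwB : w ∈ subAtom B i := by
      change w + Finsupp.single i 1 ∈ B
      rw [hw]
      exact hleast B hB
    obtain ⟨p, hp, hsub⟩ := hB.sub_eq i ⟨least B, hleast B hB, by rw [← hw]; simp⟩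
    have hwp : factorizationHom N w = p := by
      rw [hsub] at hwB
      exact hwB
    refine ⟨by rw [hwp]; exact hp, fun v hv hlt => ?_⟩
    have hvB : v ∈ subAtom B i := by
      rw [hsub]
      exact hv.trans hwp
    exact hleast_min B hB _ hvB (hw ▸ hadd _ _ _ hlt)
  · have hB : IsOuterBetti B := hB
    have hB' : IsOuterBetti B' := hB'
    exact (hB.subset_of_mem hB' (hleast B hB) (h ▸ hleast B' hB')).antisymm
      (hB'.subset_of_mem hB (hleast B' hB') (h ▸ hleast B hB))

theorem numOuterBetti_add_encard_le [Finite N] {ρ : Set (Factorization N × Factorization N)}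
    (hρ : IsMinPresentation N ρ) :
    (embCodim N ≤ 2 → numOuterBetti N + ρ.encard ≤ ((embDim N).choose 2 : ℕ∞)) ∧
    (embCodim N = 3 → numOuterBetti N + ρ.encard ≤ ((embDim N).choose 2 : ℕ∞) + 1) := by
  classical
  let := Fintype.ofFinite (Atom N)
  obtain ⟨lt, hlt, hadd, -⟩ := exists_isWellOrder_refining (0 : Factorization N →+ ℕ)
  obtain ⟨σ, hσ, rfl⟩ := hρ
  have hν : ∀ a b : N, a ∈ ({nil} : Set N) → a + b ∈ ({nil} : Set N) := by
    rintro a b rfl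
    exact nil_add b
  set D := canonicalFactorizations {(nil : N)} lt
  have hmaps : Set.MapsTo (factorizationHom N) D {a | a ≠ nil} := fun z hz => hz.1
  have hinj : Set.InjOn (factorizationHom N) D := canonicalFactorizations_injOn
  have hDfin : D.Finite := Set.Finite.of_injOn hmaps hinj (Set.toFinite _)
  have hDcard : D.ncard ≤ multiplicity N :=
    Set.ncard_le_ncard_of_injOn _ hmaps hinj (Set.toFinite _)
  have hcorners : numOuterBetti N + {t ∈ σ | factorizationHom N t.1 ≠ nil}.encard ≤
      {z ∈ corners D | z.support ⊆ Finset.univ}.encard := by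
    have hdisj : Disjoint {z ∈ corners D | factorizationHom N z = nil}
        {z ∈ corners D | factorizationHom N z ∉ ({nil} : Set N)} :=
      Set.disjoint_left.mpr fun z hz hz' => hz'.2 hz.2
    refine (add_le_add (numOuterBetti_le_corners hadd)
      (hσ.encard_le_corners hν hadd partly_cancel)).trans ?_
    rw [← Set.encard_union_eq hdisj]
    refine Set.encard_le_encard ?_
    rintro z (hz | hz) <;> exact ⟨hz.1, Finset.subset_univ _⟩
  have hdim : embDim N = (Finset.univ : Finset (Atom N)).card + 1 := by
    rw [Finset.card_univ, embDim, Nat.card_eq_fintype_card]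
  have key := fun (r : ℕ) (hr : D.ncard ≤ 1 + (Finset.univ : Finset (Atom N)).card + r) =>
    corners_encard_le hDfin
      (fun w i h => mem_canonicalFactorizations_of_add_single hν hadd h)
      (fun z _ => Finset.subset_univ _) (zero_mem_canonicalFactorizations nil_ne_zero.symm)
      (fun i _ => single_mem_canonicalFactorizations eq_zero_of_isAddUnit (atom_ne_nil i)) hr
  rw [hdim]
  constructor <;> intro hr <;> rw [embCodim] at hr
  · exact hcorners.trans ((key 2 (by omega)).1 le_rfl)
  · exact_mod_cast hcorners.trans ((key 3 (by omega)).2 rfl)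

end PartlyCancellativeNilsemigroup

/-! ### Numerical semigroups -/

namespace NumericalSemigroup

variable {S : AddSubmonoid ℕ}

theorem eq_zero_of_isAddUnit (a : S) (ha : IsAddUnit a) : a = 0 := by
  obtain ⟨b, hb⟩ := ha.exists_neg
  have h : (a : ℕ) + b = 0 := congrArg Subtype.val hb
  exact Subtype.ext (by simpa using (Nat.add_eq_zero_iff.mp h).1)

theorem coe_ne_zero_of_not_isAddUnit {a : S} (ha : ¬ IsAddUnit a) : (a : ℕ) ≠ 0 := fun h =>
  ha (by rw [show a = 0 from Subtype.ext h]; exact isAddUnit_zero)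

theorem exists_factorization (s : S) : ∃ z, factorizationHom S z = s := by
  obtain ⟨n, hn⟩ := s
  induction n using Nat.strong_induction_on with
  | _ n ih =>
    by_cases h0 : n = 0
    · exact ⟨0, by rw [map_zero]; exact Subtype.ext h0.symm⟩
    by_cases hirr : AddIrreducible (⟨n, hn⟩ : S)
    · exact ⟨Finsupp.single ⟨_, hirr⟩ 1, by rw [factorizationHom_single, one_smul]⟩
    have hnu : ¬ IsAddUnit (⟨n, hn⟩ : S) := fun h =>
      h0 (congrArg Subtype.val (eq_zero_of_isAddUnit _ h))
    obtain ⟨a, b, hab, ha, hb⟩ : ∃ a b : S, ⟨n, hn⟩ = a + b ∧ ¬ IsAddUnit a ∧ ¬ IsAddUnit b := by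
      by_contra! hcon
      exact hirr ⟨hnu, fun a b hab => or_iff_not_imp_left.mpr (hcon a b hab)⟩
    have hval : n = (a : ℕ) + b := congrArg Subtype.val hab
    have ha0 : (a : ℕ) ≠ 0 := coe_ne_zero_of_not_isAddUnit ha
    have hb0 : (b : ℕ) ≠ 0 := coe_ne_zero_of_not_isAddUnit hb
    obtain ⟨x, hx⟩ := ih a (by omega) a.2
    obtain ⟨y, hy⟩ := ih b (by omega) b.2
    exact ⟨x + y, by rw [map_add, hx, hy, hab]⟩

theorem multiplicity_mem (hS : IsNumerical S) : multiplicity S ∈ S ∧ multiplicity S ≠ 0 := by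
  refine Nat.sInf_mem (s := {n | n ∈ S ∧ n ≠ 0}) ?_
  have hinf : ((S : Set ℕ) \ {0}).Infinite :=
    (Set.infinite_of_finite_compl hS).sdiff (Set.finite_singleton 0)
  obtain ⟨n, hn, hn0⟩ := hinf.nonempty
  exact ⟨n, hn, hn0⟩

theorem multiplicity_le {n : ℕ} (hn : n ∈ S) (h0 : n ≠ 0) : multiplicity S ≤ n :=
  Nat.sInf_le ⟨hn, h0⟩

theorem addIrreducible_multiplicity (hS : IsNumerical S) :
    AddIrreducible (⟨multiplicity S, (multiplicity_mem hS).1⟩ : S) := by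
  refine ⟨fun h => (multiplicity_mem hS).2 (congrArg Subtype.val (eq_zero_of_isAddUnit _ h)),
    fun a b hab => ?_⟩
  have hval : multiplicity S = (a : ℕ) + b := congrArg Subtype.val hab
  by_contra! hcon
  have ha0 : (a : ℕ) ≠ 0 := coe_ne_zero_of_not_isAddUnit hcon.1
  have hb0 : (b : ℕ) ≠ 0 := coe_ne_zero_of_not_isAddUnit hcon.2
  have h1 := multiplicity_le a.2 ha0
  omega

/-- The Apéry set of `S` with respect to its multiplicity `m`: the elements `s` for which `s - m` is
not an element of `S`. -/
def apery (S : AddSubmonoid ℕ) : Set S := {s | ∀ t : S, (s : ℕ) ≠ t + multiplicity S}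

theorem apery_mod_injOn (hS : IsNumerical S) :
    Set.InjOn (fun s : S => (s : ℕ) % multiplicity S) (apery S) := by
  have hwlog : ∀ s ∈ apery S, ∀ t ∈ apery S, (s : ℕ) % multiplicity S = t % multiplicity S →
      (t : ℕ) ≤ s := by
    intro s hs t ht h
    by_contra! hlt
    obtain ⟨k, hk⟩ := (Nat.modEq_iff_dvd' hlt.le).mp h
    obtain ⟨j, rfl⟩ : ∃ j, k = j + 1 := Nat.exists_eq_succ_of_ne_zero (by rintro rfl; omega)
    refine ht ⟨s + j * multiplicity S, S.add_mem s.2 ?_⟩ ?_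
    · simpa using S.nsmul_mem (multiplicity_mem hS).1 j
    · have : (t : ℕ) = s + multiplicity S * (j + 1) := by omega
      rw [this]
      ring
  intro s hs t ht h
  exact Subtype.ext ((hwlog t ht s hs h.symm).antisymm (hwlog s hs t ht h))

theorem apery_finite_and_ncard_le (hS : IsNumerical S) :
    (apery S).Finite ∧ (apery S).ncard ≤ multiplicity S := by
  have hmaps : Set.MapsTo (fun s : S => (s : ℕ) % multiplicity S) (apery S)
      (Finset.range (multiplicity S) : Set ℕ) := fun s _ => by
    simpa using Nat.mod_lt _ (Nat.pos_of_ne_zero (multiplicity_mem hS).2)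
  refine ⟨Set.Finite.of_injOn hmaps (apery_mod_injOn hS) (Finset.finite_toSet _), ?_⟩
  have h := Set.ncard_le_ncard_of_injOn _ hmaps (apery_mod_injOn hS) (Finset.finite_toSet _)
  rwa [Set.ncard_coe_finset, Finset.card_range] at h

theorem atom_mem_apery {a : Atom S} (ha : ((a : S) : ℕ) ≠ multiplicity S)
    (hS : IsNumerical S) : (a : S) ∈ apery S := by
  intro t ht
  rcases a.2.isAddUnit_or_isAddUnit (a := t) (b := ⟨_, (multiplicity_mem hS).1⟩)
    (Subtype.ext ht) with h | h
  · rw [eq_zero_of_isAddUnit _ h] at ht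
    exact ha (by simpa using ht)
  · exact (multiplicity_mem hS).2 (congrArg Subtype.val (eq_zero_of_isAddUnit _ h))

/-- The canonical factorizations are taken with respect to an order that first compares the part of
the value not contributed by the multiplicity `m`; among factorizations of one element, this puts
those with more copies of `m` first. Hence every canonical factorization without `m` is a
factorization of an element of the Apéry set, and no corner contains `m`. -/
theorem encard_le {ρ : Set (Factorization S × Factorization S)} (hS : IsNumerical S)
    (hρ : IsMinimalPresentation S ρ) :
    (embCodim S ≤ 2 → ρ.encard ≤ ((embDim S).choose 2 : ℕ∞)) ∧
    (embCodim S = 3 → ρ.encard ≤ ((embDim S).choose 2 : ℕ∞) + 1) := by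
  classical
  let μ : Atom S := ⟨_, addIrreducible_multiplicity hS⟩
  have hAfin : {a : Atom S | a ≠ μ}.Finite := by
    refine Set.Finite.of_injOn (f := Subtype.val) (t := apery S) (fun a ha => ?_)
      Subtype.val_injective.injOn (apery_finite_and_ncard_le hS).1
    exact atom_mem_apery (fun h => ha (Subtype.ext (Subtype.ext h))) hS
  have hfin : Finite (Atom S) := by
    refine Set.finite_univ_iff.mp ((hAfin.insert μ).subset fun a _ => ?_)
    exact or_iff_not_imp_left.mpr id
  let := Fintype.ofFinite (Atom S)
  let A : Finset (Atom S) := Finset.univ.erase μ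
  have hA : ∀ z : Factorization S, z.support ⊆ A ↔ z μ = 0 := fun z => by
    rw [Finset.subset_erase]
    simp
  let wt : Factorization S →+ ℕ :=
    (Finsupp.linearCombination ℕ fun a : Atom S =>
      if a = μ then 0 else ((a : S) : ℕ)).toAddMonoidHom
  have hwt : ∀ z, (factorizationHom S z : ℕ) = z μ * multiplicity S + wt z := by
    intro z
    induction z using Finsupp.induction_linear with
    | zero => simp
    | add x y hx hy =>
      rw [map_add, map_add, AddSubmonoid.coe_add, hx, hy, Finsupp.add_apply]
      ring
    | single a n =>
      rw [factorizationHom_single]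
      by_cases ha : a = μ
      · subst ha
        simp [wt, μ]
      · simp [wt, ha]
  obtain ⟨lt, hlt, hadd, hwtlt⟩ := exists_isWellOrder_refining wt
  have hν : ∀ a b : S, a ∈ (∅ : Set S) → a + b ∈ (∅ : Set S) := fun _ _ h => h.elim
  have hcancel : ∀ a b c : S, a + b = a + c → a + b ∉ (∅ : Set S) → b = c :=
    fun a b c h _ => add_left_cancel h
  set D := canonicalFactorizations (∅ : Set S) lt
  set D₀ := {z ∈ D | z μ = 0}
  have hmaps : Set.MapsTo (factorizationHom S) D₀ (apery S) := by
    rintro z ⟨hz, hz0⟩ t ht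
    obtain ⟨w, rfl⟩ := exists_factorization t
    refine hz.2 (w + Finsupp.single μ 1) ?_ (hwtlt _ _ ?_)
    · rw [map_add, factorizationHom_single, one_smul]
      exact Subtype.ext ht.symm
    · have h1 : wt (w + Finsupp.single μ 1) = wt w := by simp [wt]
      have h2 := hwt w
      have h3 := hwt z
      have h4 := (multiplicity_mem hS).2
      rw [hz0] at h3
      omega
  have hinj : Set.InjOn (factorizationHom S) D₀ :=
    canonicalFactorizations_injOn.mono (Set.sep_subset _ _)
  have hDfin : D₀.Finite := Set.Finite.of_injOn hmaps hinj (apery_finite_and_ncard_le hS).1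
  have hDcard : D₀.ncard ≤ multiplicity S :=
    (Set.ncard_le_ncard_of_injOn _ hmaps hinj (apery_finite_and_ncard_le hS).1).trans
      (apery_finite_and_ncard_le hS).2
  have hcorner_zero : ∀ z ∈ corners D, z μ = 0 := by
    intro z hz
    by_contra hne
    obtain ⟨u, rfl⟩ := exists_add_single_eq (Nat.pos_of_ne_zero hne)
    refine hz.1 ⟨id, fun w hw hltw => ?_⟩
    have hle : wt w ≤ wt (u + Finsupp.single μ 1) := by
      by_contra! hlt'
      exact asymm_of lt hltw (hwtlt _ _ hlt')
    have hwμ : 0 < w μ := by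
      have h1 := hwt w
      have h2 := hwt (u + Finsupp.single μ 1)
      rw [hw] at h1
      have h3 : 0 < (u + Finsupp.single μ 1 : Factorization S) μ * multiplicity S :=
        Nat.mul_pos (Nat.pos_of_ne_zero hne) (Nat.pos_of_ne_zero (multiplicity_mem hS).2)
      by_contra! h0
      rw [Nat.le_zero.mp h0] at h1
      omega
    obtain ⟨v, rfl⟩ := exists_add_single_eq hwμ
    have hvu : factorizationHom S v = factorizationHom S u := by
      rw [map_add, map_add] at hw
      exact add_right_cancel hw
    rcases trichotomous_of lt v u with h | h | h
    · exact (hz.2 u μ rfl).2 v hvu h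
    · rw [h] at hltw
      exact irrefl_of lt _ hltw
    · exact asymm_of lt hltw (hadd _ _ _ h)
  have hcorners : ρ.encard ≤ {z ∈ corners D₀ | z.support ⊆ A}.encard := by
    have h := hρ.encard_le_corners hν hadd hcancel
    simp only [Set.mem_empty_iff_false, not_false_eq_true, and_true] at h
    refine h.trans (Set.encard_le_encard fun z hz => ?_)
    have hz0 := hcorner_zero z hz
    refine ⟨⟨fun h => hz.1 h.1, fun w i hw => ⟨hz.2 w i hw, ?_⟩⟩, (hA z).mpr hz0⟩
    rw [← hw, Finsupp.add_apply] at hz0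
    omega
  have hdim : embDim S = A.card + 1 := by
    rw [Finset.card_erase_add_one (Finset.mem_univ _), Finset.card_univ, embDim,
      Nat.card_eq_fintype_card]
  have key := fun (r : ℕ) (hr : D₀.ncard ≤ 1 + A.card + r) =>
    corners_encard_le hDfin
      (fun w i h => ⟨mem_canonicalFactorizations_of_add_single hν hadd h.1, by
        have := h.2
        rw [Finsupp.add_apply] at this
        omega⟩)
      (fun z hz => (hA z).mpr hz.2)
      ⟨zero_mem_canonicalFactorizations (Set.notMem_empty _), rfl⟩
      (fun i hi => ⟨single_mem_canonicalFactorizations eq_zero_of_isAddUnit (Set.notMem_empty _),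
        Finsupp.single_eq_of_ne (Finset.ne_of_mem_erase hi).symm⟩) hr
  rw [hdim]
  constructor <;> intro hr <;> rw [embCodim] at hr
  · exact hcorners.trans ((key 2 (by omega)).1 le_rfl)
  · exact_mod_cast hcorners.trans ((key 3 (by omega)).2 rfl)

end NumericalSemigroup

/-! ### Bounds in small embedding codimension -/

theorem theoremt :
    (∀ (N : Type*) [PartlyCancellativeNilsemigroup N] [Finite N]
        (ρ : Set (Factorization N × Factorization N)),
      PartlyCancellativeNilsemigroup.IsMinPresentation N ρ →
        (PartlyCancellativeNilsemigroup.embCodim N ≤ 2 →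
          PartlyCancellativeNilsemigroup.numOuterBetti N + ρ.encard ≤
            ((PartlyCancellativeNilsemigroup.embDim N).choose 2 : ℕ∞)) ∧
        (PartlyCancellativeNilsemigroup.embCodim N = 3 →
          PartlyCancellativeNilsemigroup.numOuterBetti N + ρ.encard ≤
            ((PartlyCancellativeNilsemigroup.embDim N).choose 2 : ℕ∞) + 1)) ∧
    (∀ (S : AddSubmonoid ℕ), NumericalSemigroup.IsNumerical S →
      ∀ ρ : Set (Factorization S × Factorization S), IsMinimalPresentation S ρ →
        (NumericalSemigroup.embCodim S ≤ 2 →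
          ρ.encard ≤ ((NumericalSemigroup.embDim S).choose 2 : ℕ∞)) ∧
        (NumericalSemigroup.embCodim S = 3 →
          ρ.encard ≤ ((NumericalSemigroup.embDim S).choose 2 : ℕ∞) + 1)) := by
  exact ⟨fun N _ _ ρ hρ => PartlyCancellativeNilsemigroup.numOuterBetti_add_encard_le hρ,
    fun S hS ρ hρ => NumericalSemigroup.encard_le hS hρ⟩
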